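/- Consider causal bandits over $n$ variables $X_1,\dots,X_n$ with a common finite domain $\mathcal V$, $|\mathcal V|=M$. An instance $\nu$ consists of a DAG $D$ on the variables, a conditional distribution of every variable for every configuration of its parents, a reward generating variable $X_R\in\{X_1,\dots,X_n\}$, and a real reward $\mathbf R$ which, given all variables, is $N(f(X_R),1)$-distributed for some function $f:\mathcal V\to\mathbb R$. The intervention $\mathrm{do}(X_i=v)$ replaces the conditional distribution of $X_i$ by the point mass at $v$; $\mathrm{do}()$ is the empty intervention. The learner has the $nK$ actions $\mathrm{do}(X_i=v)$, $1\le i\le n$, $v\in\mathcal K$, where $\mathcal K\subseteq\mathcal V$ is a set of $K$ values ($\mathcal K=\mathcal V$ is allowed). In every round the learner chooses an action, possibly at random, on the basis of all previous actions and observations, and then observes the values of all variables and the reward. Let $\mu_a=\mathbb E[\mathbf R\mid a]$, $\mu_{a^*}=\max_a\mu_a$, and $\mathbb E[R_T(\pi,\nu)]=\mathbb E\big[T\mu_{a^*}-\sum_{t=1}^T\mu_{a_t}\big]$ for a policy $\pi$ that plays $a_1,\dots,a_T$ on $\nu$. For $\varepsilon\in(0,1)$ let $\mathcal E_\varepsilon$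 be the set of the instances for which the reward under every action $a$ is Gaussian of variance $1$ with mean $\mu_a\in[0,1]$, and which * satisfy causal effect identifiability with the constant $\varepsilon$: for every edge $X_i\to X_j$ of $D$ there are $x,x'\in\mathcal V$ with $|P(X_j=x\mid \mathrm{do}(X_i=x'))-P(X_j=x)|>\varepsilon$; * violate reward identifiability: there is no $\Delta>0$ such that every ancestor $X$ of $X_R$ in $D$ has some $x\in\mathcal V$ with $|\mathbb E[\mathbf R\mid\mathrm{do}()]-\mathbb E[\mathbf R\mid\mathrm{do}(X=x)]|\ge\Delta$ (ancestors of $X_R$ are the variables other than $X_R$ from which a directed path leads to $X_R$). Then there is an absolute constant $c>0$ such that for all $n\ge2$, $K\ge1$, $M\ge\max\{K,3\}$, all $T\ge nK$ and all $\varepsilon\in(0,1)$, $$\inf_{\pi\in\Pi}\ \sup_{\nu\in\mathcal E_\varepsilon}\ \mathbb E[R_T(\pi,\nu)]\ \ge\ c\sqrt{nKT},$$ where $\Pi$ is the set of all policies. -/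

import Mathlib

open MeasureTheory ProbabilityTheory
open scoped ENNReal NNReal

noncomputable section

/-- A causal bandit instance over `n` variables, each with the domain `Fin (K + e)`. The learner can
set a variable to any of the first `K` values, and `e` is the number of the remaining domain values
(`e = 0`: every value can be set).

The instance consists of a DAG on the variables, of a conditional distribution of each variable for
every configuration of its parents, of the reward generating variable, and of the expected reward
for each value of that variable. -/
structure CausalBandit (n K e : ℕ) where
  /-- `edge i j` : there is an edge from variable `i` to variable `j`. -/
  edge : Fin n → Fin n → Prop
  acyclic : ∀ i, ¬ Relation.TransGen edge i i
  /-- The distribution of variable `i` given the values of its parents. -/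
  cpd : (i : Fin n) → ({j : Fin n // edge j i} → Fin (K + e)) → PMF (Fin (K + e))
  /-- The reward generating variable. -/
  rewardVar : Fin n
  /-- Expected reward as a function of the value of the reward generating variable. -/
  rewardFun : Fin (K + e) → ℝ

/-- Interventions on at most one variable: `none` is the empty intervention `do()` and
`some (i, v)` is `do(X_i = v)`. -/
abbrev Intervention (n K e : ℕ) : Type := Option (Fin n × Fin (K + e))

/-- What is observed in one round: the values of all variables and the reward. -/
abbrev Observation (n K e : ℕ) : Type := (Fin n → Fin (K + e)) × ℝ

/-- The `n * K` actions of the learner. -/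
abbrev Arm (n K : ℕ) : Type := Fin n × Fin K

/-- The history of `t` rounds: the action played and the observation made in every round. -/
abbrev History (n K e t : ℕ) : Type := Fin t → Arm n K × Observation n K e

/-- The intervention that an action performs. -/
def Arm.toIntervention {n K : ℕ} (e : ℕ) (a : Arm n K) : Intervention n K e :=
  some (a.1, Fin.castAdd e a.2)

namespace CausalBandit

variable {n K e : ℕ} (ν : CausalBandit n K e)

/-- The conditional distribution of variable `i` given the values of its parents, after an
intervention: the intervened variable is cut off from its parents and takes the prescribed value,
the other variables keep their distributions. -/
def mechanism (a : Intervention n K e) (i : Fin n)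
    (p : {j : Fin n // ν.edge j i} → Fin (K + e)) : PMF (Fin (K + e)) :=
  match a with
  | none => ν.cpd i p
  | some (j, v) => if i = j then PMF.pure v else ν.cpd i p

/-- The probability of the configuration `x` of all the variables under an intervention: the
(truncated) factorization over the DAG. -/
def weight (a : Intervention n K e) (x : Fin n → Fin (K + e)) : ℝ≥0∞ :=
  ∏ i, ν.mechanism a i (fun j => x j) (x i)

/-- The joint law of the variables under an intervention (of total mass one, as the graph is
acyclic). -/
def variableLaw (a : Intervention n K e) : Measure (Fin n → Fin (K + e)) :=
  ∑ x, ν.weight a x • Measure.dirac x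

/-- The joint law of the variables and the reward under an intervention: given the values `x` of the
variables, the reward is `N(μ, 1)`-distributed where `μ` depends only on the value of the reward
generating variable. -/
def outcomeLaw (a : Intervention n K e) : Measure (Observation n K e) :=
  ∑ x, ν.weight a x •
    (Measure.dirac x).prod (gaussianReal (ν.rewardFun (x ν.rewardVar)) 1)

/-- `E[R | a]`. -/
def meanReward (a : Intervention n K e) : ℝ := ∫ o, o.2 ∂(ν.outcomeLaw a)

/-- `P(X_i = v | a)`. -/
def prob (a : Intervention n K e) (i : Fin n) (v : Fin (K + e)) : ℝ :=
  (ν.variableLaw a).real {x | x i = v}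

/-- `μ_a` for an action `a`. -/
def armMean (a : Arm n K) : ℝ := ν.meanReward (a.toIntervention e)

/-- The expected reward of an optimal action (a maximum over a finite set). -/
def optMean : ℝ := ⨆ a : Arm n K, ν.armMean a

/-- Under every action, the reward has a Gaussian distribution (of unit variance). -/
def GaussianRewards : Prop :=
  ∀ a : Arm n K,
    (ν.outcomeLaw (a.toIntervention e)).map Prod.snd = gaussianReal (ν.armMean a) 1

/-- The expected reward of every action lies in `[0, 1]`. -/
def BoundedMeans : Prop := ∀ a : Arm n K, ν.armMean a ∈ Set.Icc (0 : ℝ) 1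

/-- Causal effect identifiability with the constant `ε`. -/
def CausalEffectIdentifiable (ε : ℝ) : Prop :=
  ∀ i j, ν.edge i j →
    ∃ x x' : Fin (K + e), ε < |ν.prob (some (i, x')) j x - ν.prob none j x|

/-- `i` is an ancestor of `j`: there is a directed path (with at least one edge) from `i` to `j`. -/
def IsAncestor (i j : Fin n) : Prop := Relation.TransGen ν.edge i j

/-- Reward identifiability: some `Δ > 0` bounds from below the largest change of the expected reward
that interventions on any given ancestor of the reward generating variable cause. -/
def RewardIdentifiable : Prop :=
  ∃ Δ : ℝ, 0 < Δ ∧ ∀ i, ν.IsAncestor i ν.rewardVar →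
    ∃ x : Fin (K + e), Δ ≤ |ν.meanReward none - ν.meanReward (some (i, x))|

/-- The law of the observation of one round, as a kernel from the action played. -/
def armKernel : Kernel (Arm n K) (Observation n K e) :=
  Kernel.ofFunOfCountable fun a => ν.outcomeLaw (a.toIntervention e)

end CausalBandit

/-- The `n * K`-armed Gaussian causal bandits that satisfy causal effect identifiability with the
constant `ε` and violate reward identifiability. -/
def hardClass (n K e : ℕ) (ε : ℝ) : Set (CausalBandit n K e) :=
  {ν | ν.GaussianRewards ∧ ν.BoundedMeans ∧ ν.CausalEffectIdentifiable ε ∧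
    ¬ ν.RewardIdentifiable}

/-- A (randomized) policy: in every round, the distribution of the next action given all that has
been played and observed so far. -/
structure Policy (n K e : ℕ) where
  act : (t : ℕ) → Kernel (History n K e t) (Arm n K)
  markov : ∀ t, IsMarkovKernel (act t)

/-- The law of the history of `t` rounds when the policy `π` interacts with the instance `ν`. -/
def historyLaw {n K e : ℕ} (ν : CausalBandit n K e) (π : Policy n K e) :
    (t : ℕ) → Measure (History n K e t)
  | 0 => Measure.dirac Fin.elim0
  | t + 1 =>
    (historyLaw ν π t ⊗ₘ
      (π.act t ⊗ₖ Kernel.prodMkLeft (History n K e t) ν.armKernel)).map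
        fun p => Fin.snoc (α := fun _ => Arm n K × Observation n K e) p.1 p.2

/-- The expected regret `E[T μ_{a*} - ∑ t, μ_{a_t}]` of `π` on `ν` over `T` rounds. -/
def expectedRegret {n K e : ℕ} (ν : CausalBandit n K e) (π : Policy n K e) (T : ℕ) : ℝ :=
  ∫ h, (T * ν.optMean - ∑ t : Fin T, ν.armMean (h t).1) ∂(historyLaw ν π T)

end

/-! The two conditions on the instances leave room for an ordinary bandit problem. In a
deterministic star, variable `0` drives all the others, so every edge has an effect of size 1; yet
all values that arise without setting the reward variable directly lie in `{u, w}`, where the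
expected reward is `1 / 2`. The reward thus ignores its only ancestor, and reward identifiability
fails. If the reward peaks at a third value, exactly one action `c` has a mean other than `1 / 2`.
The variables are functions of the action that do not depend on `c`, so observing them reveals
nothing about `c`.

It remains to prove the usual minimax bound for the set `C` of possible `c`, which contains at least
a sixth of all actions. The log-likelihood ratio of two such instances is a sum over the rounds in
which `c` is played, so the relative entropy of the histories is `δ ^ 2 / 2` times the expected
number of plays of `c` (`integral_historyLaw_le_of_deterministic`). With at least two candidates,
one of them is played at most `T / C.card` times on average when all means are equal; raising its
mean by a multiple of `√(C.card / T)` goes nearly unnoticed and costs regret of order `√(C.card *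
T)`. A single candidate calls for a two-point argument, with its mean slightly below or slightly
above `1 / 2`. -/

/-! ### Laws of histories: additive functionals and change of measure. -/

section Histories

variable {n K e : ℕ}

attribute [instance] Policy.markov

/-- The sum over the rounds of a history of a function of the action and the observation. -/
def roundSum (ℓ : Arm n K × Observation n K e → ℝ) {t : ℕ} (h : History n K e t) : ℝ :=
  ∑ s, ℓ (h s)

/-- The number of times that an action is played in a history. -/
def pullCount (c : Arm n K) {t : ℕ} (h : History n K e t) : ℝ :=
  roundSum (fun p => if p.1 = c then 1 else 0) h

theorem measurable_roundSum {ℓ : Arm n K × Observation n K e → ℝ} (hℓ : Measurable ℓ) (t : ℕ) :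
    Measurable (roundSum ℓ : History n K e t → ℝ) := by
  unfold roundSum
  fun_prop

theorem measurable_armIndicator (c : Arm n K) :
    Measurable fun p : Arm n K × Observation n K e => if p.1 = c then (1 : ℝ) else 0 :=
  (measurable_of_countable fun a : Arm n K => if a = c then (1 : ℝ) else 0).comp measurable_fst

theorem measurable_pullCount (c : Arm n K) (t : ℕ) :
    Measurable (pullCount c : History n K e t → ℝ) :=
  measurable_roundSum (measurable_armIndicator c) t

theorem measurable_historySnoc (t : ℕ) :
    Measurable fun p : History n K e t × (Arm n K × Observation n K e) =>
      (Fin.snoc (α := fun _ => Arm n K × Observation n K e) p.1 p.2 : History n K e (t + 1)) := by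
  refine measurable_pi_iff.2 fun s => ?_
  induction s using Fin.lastCases with
  | last => simpa using measurable_snd
  | cast s =>
    simp only [Fin.snoc_castSucc]
    fun_prop

theorem roundSum_snoc (ℓ : Arm n K × Observation n K e → ℝ) {t : ℕ} (h : History n K e t)
    (p : Arm n K × Observation n K e) :
    roundSum ℓ (Fin.snoc (α := fun _ => Arm n K × Observation n K e) h p : History n K e (t + 1)) =
      roundSum ℓ h + ℓ p := by
  simp [roundSum, Fin.sum_univ_castSucc]

theorem pullCount_nonneg (c : Arm n K) {t : ℕ} (h : History n K e t) : 0 ≤ pullCount c h := by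
  unfold pullCount roundSum
  refine Finset.sum_nonneg fun s _ => ?_
  beta_reduce
  split_ifs <;> norm_num

theorem pullCount_le (c : Arm n K) {t : ℕ} (h : History n K e t) : pullCount c h ≤ t := by
  unfold pullCount roundSum
  calc _ ≤ ∑ _s : Fin t, (1 : ℝ) := by
        refine Finset.sum_le_sum fun s _ => ?_
        beta_reduce
        split_ifs <;> norm_num
    _ = t := by simp

theorem sum_pullCount_le (C : Finset (Arm n K)) {t : ℕ} (h : History n K e t) :
    ∑ c ∈ C, pullCount c h ≤ t := by
  unfold pullCount roundSum
  rw [Finset.sum_comm]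
  calc _ ≤ ∑ _s : Fin t, (1 : ℝ) := by
        refine Finset.sum_le_sum fun s _ => ?_
        rw [Finset.sum_ite_eq]
        split_ifs <;> norm_num
    _ = t := by simp

variable (ν : CausalBandit n K e) (π : Policy n K e)

instance isProbabilityMeasure_historyLaw [IsMarkovKernel ν.armKernel] :
    ∀ t, IsProbabilityMeasure (historyLaw ν π t)
  | 0 => by unfold historyLaw; infer_instance
  | t + 1 => by
    have := isProbabilityMeasure_historyLaw t
    unfold historyLaw
    exact Measure.isProbabilityMeasure_map (measurable_historySnoc t).aemeasurable

theorem lintegral_historyLaw_succ [IsMarkovKernel ν.armKernel] (t : ℕ)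
    {f : History n K e (t + 1) → ℝ≥0∞} (hf : Measurable f) :
    ∫⁻ h, f h ∂historyLaw ν π (t + 1) =
      ∫⁻ h, ∫⁻ a, ∫⁻ o, f (Fin.snoc (α := fun _ => Arm n K × Observation n K e) h (a, o))
        ∂ν.armKernel a ∂π.act t h ∂historyLaw ν π t := by
  have hs := measurable_historySnoc (n := n) (K := K) (e := e) t
  have hfs : Measurable fun p : History n K e t × (Arm n K × Observation n K e) =>
      f (Fin.snoc (α := fun _ => Arm n K × Observation n K e) p.1 p.2) := hf.comp hs
  rw [historyLaw, lintegral_map hf hs, Measure.lintegral_compProd hfs]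
  refine lintegral_congr fun h => ?_
  exact Kernel.lintegral_compProd _ _ _ (hfs.comp measurable_prodMk_left)

/-- The law of the action in round `t`. -/
noncomputable def actionLaw (t : ℕ) : Measure (Arm n K) := (historyLaw ν π t).bind (π.act t)

instance isProbabilityMeasure_actionLaw [IsMarkovKernel ν.armKernel] (t : ℕ) :
    IsProbabilityMeasure (actionLaw ν π t) := by
  unfold actionLaw; infer_instance

theorem map_init_historyLaw [IsMarkovKernel ν.armKernel] (t : ℕ) :
    (historyLaw ν π (t + 1)).map (fun h s => h (Fin.castSucc s)) = historyLaw ν π t := by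
  have hm : Measurable fun (h : History n K e (t + 1)) (s : Fin t) => h (Fin.castSucc s) := by
    fun_prop
  refine Measure.ext_of_lintegral _ fun f hf => ?_
  rw [lintegral_map hf hm,
    lintegral_historyLaw_succ ν π t (f := fun h => f fun s => h s.castSucc) (hf.comp hm)]
  simp

theorem map_last_historyLaw [IsMarkovKernel ν.armKernel] (t : ℕ) :
    (historyLaw ν π (t + 1)).map (fun h => h (Fin.last t)) = actionLaw ν π t ⊗ₘ ν.armKernel := by
  have hm : Measurable fun h : History n K e (t + 1) => h (Fin.last t) := by fun_prop
  refine Measure.ext_of_lintegral _ fun f hf => ?_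
  rw [lintegral_map hf hm,
    lintegral_historyLaw_succ ν π t (f := fun h => f (h (Fin.last t))) (hf.comp hm),
    Measure.lintegral_compProd hf, actionLaw,
    Measure.lintegral_bind (π.act t).aemeasurable (hf.lintegral_kernel_prod_right').aemeasurable]
  simp

theorem integrable_compProd_armKernel [IsMarkovKernel ν.armKernel] (ρ : Measure (Arm n K))
    [IsFiniteMeasure ρ] {ℓ : Arm n K × Observation n K e → ℝ} (hℓ : Measurable ℓ)
    (hi : ∀ a, Integrable (fun o => ℓ (a, o)) (ν.armKernel a)) :
    Integrable ℓ (ρ ⊗ₘ ν.armKernel) :=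
  (Measure.integrable_compProd_iff hℓ.aestronglyMeasurable).2
    ⟨.of_forall hi, Integrable.of_finite⟩

theorem integrable_roundSum [IsMarkovKernel ν.armKernel]
    {ℓ : Arm n K × Observation n K e → ℝ} (hℓ : Measurable ℓ)
    (hi : ∀ a, Integrable (fun o => ℓ (a, o)) (ν.armKernel a)) (t : ℕ) :
    Integrable (roundSum ℓ) (historyLaw ν π t) := by
  induction t with
  | zero => simp
  | succ t ih =>
    have h1 := ih
    rw [← map_init_historyLaw ν π t] at h1
    have h1 := h1.comp_measurable (by fun_prop)
    have h2 := integrable_compProd_armKernel ν (actionLaw ν π t) hℓ hi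
    rw [← map_last_historyLaw ν π t] at h2
    have h2 := h2.comp_measurable (by fun_prop)
    refine (h1.add h2).congr (.of_forall fun h => ?_)
    simp [Fin.sum_univ_castSucc, roundSum]

/-- The first `t` rounds and the last round enter a sum separately, so the two marginals of the
history law suffice; their dependence plays no role. -/
theorem integral_roundSum_succ [IsMarkovKernel ν.armKernel]
    {ℓ : Arm n K × Observation n K e → ℝ} (hℓ : Measurable ℓ)
    (hi : ∀ a, Integrable (fun o => ℓ (a, o)) (ν.armKernel a)) (t : ℕ) :
    ∫ h, roundSum ℓ h ∂historyLaw ν π (t + 1) =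
      ∫ h, roundSum ℓ h ∂historyLaw ν π t +
        ∫ a, ∫ o, ℓ (a, o) ∂ν.armKernel a ∂actionLaw ν π t := by
  have hm1 : Measurable fun (h : History n K e (t + 1)) (s : Fin t) => h (Fin.castSucc s) := by
    fun_prop
  have hm2 : Measurable fun h : History n K e (t + 1) => h (Fin.last t) := by fun_prop
  have h1 := integrable_roundSum ν π hℓ hi t
  rw [← map_init_historyLaw ν π t] at h1
  have h1 := h1.comp_measurable hm1
  have h2 := integrable_compProd_armKernel ν (actionLaw ν π t) hℓ hi
  rw [← Measure.integral_compProd h2, ← map_last_historyLaw ν π t,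
    integral_map hm2.aemeasurable hℓ.aestronglyMeasurable]
  rw [← map_last_historyLaw ν π t] at h2
  have h2 := h2.comp_measurable hm2
  have h3 : ∫ h, roundSum ℓ h ∂historyLaw ν π t =
      ∫ h, roundSum ℓ (fun s => h (Fin.castSucc s)) ∂historyLaw ν π (t + 1) := by
    conv_lhs => rw [← map_init_historyLaw ν π t]
    rw [integral_map hm1.aemeasurable (measurable_roundSum hℓ t).aestronglyMeasurable]
  rw [h3]
  refine Eq.trans ?_ (integral_add h1 h2)
  refine integral_congr_ae (.of_forall fun h => ?_)
  simp [roundSum, Fin.sum_univ_castSucc]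

/-- Functions of a round with equal conditional expectations given the action have equal expected
sums. -/
theorem integral_roundSum_congr [IsMarkovKernel ν.armKernel]
    {ℓ ℓ' : Arm n K × Observation n K e → ℝ} (hℓ : Measurable ℓ) (hℓ' : Measurable ℓ')
    (hi : ∀ a, Integrable (fun o => ℓ (a, o)) (ν.armKernel a))
    (hi' : ∀ a, Integrable (fun o => ℓ' (a, o)) (ν.armKernel a))
    (heq : ∀ a, ∫ o, ℓ (a, o) ∂ν.armKernel a = ∫ o, ℓ' (a, o) ∂ν.armKernel a) (t : ℕ) :
    ∫ h, roundSum ℓ h ∂historyLaw ν π t = ∫ h, roundSum ℓ' h ∂historyLaw ν π t := by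
  induction t with
  | zero => simp [roundSum]
  | succ t ih =>
    rw [integral_roundSum_succ ν π hℓ hi, integral_roundSum_succ ν π hℓ' hi', ih]
    simp_rw [heq]

theorem integrable_pullCount [IsMarkovKernel ν.armKernel] (c : Arm n K) (t : ℕ) :
    Integrable (pullCount c) (historyLaw ν π t) :=
  integrable_roundSum ν π (measurable_armIndicator c) 
    (fun a => integrable_const (if a = c then (1 : ℝ) else 0)) t

/-- If the observation laws of one instance have densities with respect to those of another
instance, so have the laws of the histories. -/
theorem lintegral_historyLaw_changeOfMeasure {ν ν' : CausalBandit n K e}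
    [IsMarkovKernel ν.armKernel] [IsMarkovKernel ν'.armKernel]
    {ℓ : Arm n K × Observation n K e → ℝ} (hℓ : Measurable ℓ)
    (hd : ∀ a, ν'.armKernel a =
      (ν.armKernel a).withDensity fun o => ENNReal.ofReal (Real.exp (ℓ (a, o)))) (t : ℕ)
    {f : History n K e t → ℝ≥0∞} (hf : Measurable f) :
    ∫⁻ h, f h ∂historyLaw ν' π t =
      ∫⁻ h, ENNReal.ofReal (Real.exp (roundSum ℓ h)) * f h ∂historyLaw ν π t := by
  induction t with
  | zero => simp [historyLaw, roundSum]
  | succ t ih =>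
    have hs := measurable_historySnoc (n := n) (K := K) (e := e) t
    have hS := measurable_roundSum (n := n) (K := K) (e := e) hℓ
    have hE : ∀ t, Measurable fun h : History n K e t =>
        ENNReal.ofReal (Real.exp (roundSum ℓ h)) := fun t => by
      have := hS t
      fun_prop
    have key : ∀ h : History n K e t, ∀ a, ∫⁻ o, f (Fin.snoc
        (α := fun _ => Arm n K × Observation n K e) h (a, o)) ∂ν'.armKernel a =
        ∫⁻ o, ENNReal.ofReal (Real.exp (ℓ (a, o))) *
          f (Fin.snoc (α := fun _ => Arm n K × Observation n K e) h (a, o)) ∂ν.armKernel a := by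
      intro h a
      rw [hd a, lintegral_withDensity_eq_lintegral_mul]
      · rfl
      · fun_prop
      · exact (hf.comp hs).comp (measurable_prodMk_left.comp measurable_prodMk_left)
    have hm : Measurable fun p : History n K e t × (Arm n K × Observation n K e) =>
        ENNReal.ofReal (Real.exp (ℓ p.2)) *
          f (Fin.snoc (α := fun _ => Arm n K × Observation n K e) p.1 p.2) := by
      have := hf.comp hs
      exact (by fun_prop : Measurable fun p : History n K e t × (Arm n K × Observation n K e) =>
        ENNReal.ofReal (Real.exp (ℓ p.2))).mul this
    have hG : Measurable fun h : History n K e t => ∫⁻ a, ∫⁻ o,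
        ENNReal.ofReal (Real.exp (ℓ (a, o))) *
          f (Fin.snoc (α := fun _ => Arm n K × Observation n K e) h (a, o))
          ∂ν.armKernel a ∂π.act t h := by
      have h1 := hm.lintegral_kernel_prod_right'
        (κ := π.act t ⊗ₖ Kernel.prodMkLeft (History n K e t) ν.armKernel)
      convert h1 using 2 with h
      exact (Kernel.lintegral_compProd (π.act t) (Kernel.prodMkLeft _ ν.armKernel) _
        (hm.comp measurable_prodMk_left)).symm
    rw [lintegral_historyLaw_succ ν' π t hf, lintegral_historyLaw_succ ν π t
      (f := fun h => ENNReal.ofReal (Real.exp (roundSum ℓ h)) * f h) ((hE _).mul hf)]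
    simp_rw [key]
    rw [ih hG]
    refine lintegral_congr fun h => ?_
    rw [← lintegral_const_mul']
    · refine lintegral_congr fun a => ?_
      rw [← lintegral_const_mul']
      · refine lintegral_congr fun o => ?_
        rw [roundSum_snoc, Real.exp_add, ENNReal.ofReal_mul (Real.exp_pos _).le, mul_assoc]
      · exact ENNReal.ofReal_ne_top
    · exact ENNReal.ofReal_ne_top

/-- The policy acts by the same kernels on both instances, so its factors cancel and the
log-likelihood ratio of a history is a sum over rounds. -/
theorem historyLaw_eq_withDensity {ν ν' : CausalBandit n K e}
    [IsMarkovKernel ν.armKernel] [IsMarkovKernel ν'.armKernel]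
    {ℓ : Arm n K × Observation n K e → ℝ} (hℓ : Measurable ℓ)
    (hd : ∀ a, ν'.armKernel a =
      (ν.armKernel a).withDensity fun o => ENNReal.ofReal (Real.exp (ℓ (a, o)))) (t : ℕ) :
    historyLaw ν' π t = (historyLaw ν π t).withDensity fun h =>
      ENNReal.ofReal (Real.exp (roundSum ℓ h)) := by
  have := measurable_roundSum (n := n) (K := K) (e := e) hℓ t
  refine Measure.ext_of_lintegral _ fun f hf => ?_
  rw [lintegral_historyLaw_changeOfMeasure π hℓ hd t hf,
    lintegral_withDensity_eq_lintegral_mul _ (by fun_prop) hf]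
  rfl

end Histories

/-! ### Comparison of expectations through relative entropy. -/

/-- A substitute for Pinsker's inequality, before the integration. -/
theorem le_mul_exp_add_of_mem_Icc {y s r : ℝ} (hy : y ∈ Set.Icc (0 : ℝ) 1) (hr : 0 < r) :
    y ≤ y * Real.exp s + r + (Real.exp s - 1 - s) / r := by
  set z := Real.exp (s / 2) with hz
  have hzz : Real.exp s = z * z := by rw [hz, ← Real.exp_add]; ring_nf
  have hz0 : 0 < z := Real.exp_pos _
  have hs : s / 2 + 1 ≤ z := Real.add_one_le_exp _
  -- A pointwise form of the bound of squared Hellinger distance by relative entropy: `s ≤ 2 * (z -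
  -- 1)`.
  have h1 : (z - 1) ^ 2 / r ≤ (Real.exp s - 1 - s) / r := by
    gcongr
    rw [hzz]; nlinarith
  have h2 : 2 * (1 - z) ≤ r + (z - 1) ^ 2 / r := by
    rw [← sub_nonneg]
    have : r + (z - 1) ^ 2 / r - 2 * (1 - z) = (r - (1 - z)) ^ 2 / r := by field_simp; ring
    rw [this]; positivity
  have h3 : 0 ≤ r + (z - 1) ^ 2 / r := by positivity
  -- For `z ≥ 1` the left side is not positive; otherwise it is at most `1 - z * z ≤ 2 * (1 - z)`.
  have h4 : y * (1 - z * z) ≤ r + (z - 1) ^ 2 / r := by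
    rcases le_total 1 z with h | h
    · nlinarith [mul_nonneg hy.1 (by nlinarith : 0 ≤ z * z - 1)]
    · have : 0 ≤ 1 - z * z := by nlinarith
      nlinarith [mul_le_mul_of_nonneg_right hy.2 this]
  rw [hzz] at h1 ⊢
  linarith

/-- A substitute for Pinsker's inequality. -/
theorem integral_le_integral_withDensity_exp_add {Ω : Type*} [MeasurableSpace Ω] {P P' : Measure Ω}
    [IsProbabilityMeasure P] [IsProbabilityMeasure P'] {S φ : Ω → ℝ} (hS : Measurable S)
    (hSi : Integrable S P) (hP' : P' = P.withDensity fun ω => ENNReal.ofReal (Real.exp (S ω)))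
    (hφ : Measurable φ) (hφ01 : ∀ ω, φ ω ∈ Set.Icc (0 : ℝ) 1) {r : ℝ} (hr : 0 < r) :
    ∫ ω, φ ω ∂P ≤ ∫ ω, φ ω ∂P' + r + (-∫ ω, S ω ∂P) / r := by
  have hE : Measurable fun ω => ENNReal.ofReal (Real.exp (S ω)) := by fun_prop
  have hmass : ∫⁻ ω, ENNReal.ofReal (Real.exp (S ω)) ∂P = 1 := by
    rw [← setLIntegral_univ, ← withDensity_apply _ .univ, ← hP', measure_univ]
  have hLi : Integrable (fun ω => Real.exp (S ω)) P := by
    refine ⟨by fun_prop, ?_⟩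
    rw [hasFiniteIntegral_iff_ofReal (.of_forall fun ω => (Real.exp_pos _).le), hmass]
    exact ENNReal.one_lt_top
  -- Since the density has integral 1, only `-∫ S`, the relative entropy of `P` with respect to
  -- `P'`, survives from the error term.
  have hL1 : ∫ ω, Real.exp (S ω) ∂P = 1 := by
    rw [integral_eq_lintegral_of_nonneg_ae (.of_forall fun ω => (Real.exp_pos _).le)
      (by fun_prop), hmass, ENNReal.toReal_one]
  have hb : ∀ᵐ ω ∂P, ‖φ ω‖ ≤ 1 := .of_forall fun ω => by
    rw [Real.norm_eq_abs, abs_of_nonneg (hφ01 ω).1]; exact (hφ01 ω).2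
  have hφi : Integrable φ P := .of_bound hφ.aestronglyMeasurable 1 hb
  have hφL : Integrable (fun ω => φ ω * Real.exp (S ω)) P :=
    hLi.bdd_mul hφ.aestronglyMeasurable hb
  have hint : ∫ ω, φ ω ∂P' = ∫ ω, φ ω * Real.exp (S ω) ∂P := by
    rw [hP', integral_withDensity_eq_integral_toReal_smul hE (.of_forall fun _ => by simp)]
    refine integral_congr_ae (.of_forall fun ω => ?_)
    simp [ENNReal.toReal_ofReal (Real.exp_pos _).le, mul_comm]
  have hK : Integrable (fun ω => (Real.exp (S ω) - 1 - S ω) / r) P :=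
    ((hLi.sub (integrable_const 1)).sub hSi).div_const r
  calc ∫ ω, φ ω ∂P
      ≤ ∫ ω, (φ ω * Real.exp (S ω) + r + (Real.exp (S ω) - 1 - S ω) / r) ∂P :=
        integral_mono hφi ((hφL.add (integrable_const r)).add hK)
          fun ω => le_mul_exp_add_of_mem_Icc (hφ01 ω) hr
    _ = _ := by
        have h1 : Integrable (fun ω => φ ω * Real.exp (S ω) + r) P := hφL.add (integrable_const r)
        have h2 : Integrable (fun ω => Real.exp (S ω) - 1) P := hLi.sub (integrable_const 1)
        rw [integral_add h1 hK, integral_add hφL (integrable_const r), integral_div,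
          integral_sub h2 hSi, integral_sub hLi (integrable_const 1), hL1, hint]
        simp

/-- The log-likelihood ratio of two Gaussian distributions of unit variance. -/
theorem gaussianReal_add_eq_withDensity (m δ : ℝ) :
    gaussianReal (m + δ) 1 = (gaussianReal m 1).withDensity fun x =>
      ENNReal.ofReal (Real.exp (δ * (x - m) - δ ^ 2 / 2)) := by
  rw [gaussianReal_of_var_ne_zero _ one_ne_zero, gaussianReal_of_var_ne_zero _ one_ne_zero,
    ← withDensity_mul _ (measurable_gaussianPDF _ _) (by fun_prop)]
  congr 1
  ext x
  simp only [gaussianPDF, gaussianPDFReal, Pi.mul_apply]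
  rw [← ENNReal.ofReal_mul (by positivity), mul_assoc (√_)⁻¹, ← Real.exp_add]
  congr 3
  simp only [NNReal.coe_one]
  ring

/-! ### Two instances that differ in the mean of one action. -/

section TwoInstances

variable {n K e : ℕ}

/-- The variables are deterministic given the action, and the reward is Gaussian. -/
def HasDeterministicVariables (ν : CausalBandit n K e) (X : Arm n K → Fin n → Fin (K + e))
    (m : Arm n K → ℝ) : Prop :=
  ∀ a, ν.armKernel a = (Measure.dirac (X a)).prod (gaussianReal (m a) 1)

theorem HasDeterministicVariables.isMarkovKernel {ν : CausalBandit n K e}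
    {X : Arm n K → Fin n → Fin (K + e)} {m : Arm n K → ℝ}
    (h : HasDeterministicVariables ν X m) : IsMarkovKernel ν.armKernel :=
  ⟨fun a => by rw [h a]; infer_instance⟩

/-- If two instances differ only in the mean reward of the action `c`, then the probabilities of an
event under both can only differ much if `c` is played often. -/
theorem integral_historyLaw_le_of_deterministic {ν ν' : CausalBandit n K e} (π : Policy n K e)
    {X : Arm n K → Fin n → Fin (K + e)} {m m' : Arm n K → ℝ}
    (h : HasDeterministicVariables ν X m) (h' : HasDeterministicVariables ν' X m')
    {c : Arm n K} {δ : ℝ} (hm : ∀ a, m' a = if a = c then m a + δ else m a) (t : ℕ)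
    {φ : History n K e t → ℝ} (hφ : Measurable φ) (hφ01 : ∀ h, φ h ∈ Set.Icc (0 : ℝ) 1)
    {r : ℝ} (hr : 0 < r) :
    ∫ h, φ h ∂historyLaw ν π t ≤ ∫ h, φ h ∂historyLaw ν' π t + r +
      δ ^ 2 / 2 * (∫ h, pullCount c h ∂historyLaw ν π t) / r := by
  have := h.isMarkovKernel
  have := h'.isMarkovKernel
  let ℓ : Arm n K × Observation n K e → ℝ := fun p =>
    if p.1 = c then δ * (p.2.2 - m c) - δ ^ 2 / 2 else 0
  -- The conditional expectation of `ℓ` given the action: the linear term is centred under `ν`.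
  -- Summed over the rounds it is a multiple of `pullCount c`.
  let ℓ' : Arm n K × Observation n K e → ℝ := fun p =>
    -(δ ^ 2 / 2) * if p.1 = c then 1 else 0
  have hℓ : Measurable ℓ :=
    Measurable.ite (measurable_fst (measurableSet_singleton c)) (by fun_prop) measurable_const
  have hℓ' : Measurable ℓ' := (measurable_armIndicator c).const_mul _
  have hd : ∀ a, ν'.armKernel a =
      (ν.armKernel a).withDensity fun o => ENNReal.ofReal (Real.exp (ℓ (a, o))) := by
    intro a
    rw [h a, h' a, hm a]
    by_cases hac : a = c
    · subst hac
      simp only [ℓ, if_true]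
      rw [gaussianReal_add_eq_withDensity]
      refine Measure.ext_of_lintegral _ fun f hf => ?_
      rw [lintegral_withDensity_eq_lintegral_mul _ (by fun_prop) hf,
        lintegral_prod _ hf.aemeasurable, lintegral_prod _ (by fun_prop),
        lintegral_dirac, lintegral_dirac,
        lintegral_withDensity_eq_lintegral_mul _ (by fun_prop) (by fun_prop)]
      rfl
    · simp [ℓ, hac]
  have hi : ∀ a, Integrable (fun o => ℓ (a, o)) (ν.armKernel a) := by
    intro a
    by_cases hac : a = c
    · simp only [ℓ, hac, if_true]
      rw [h c]
      have : Integrable (fun x : ℝ => x) (gaussianReal (m c) 1) := by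
        exact (memLp_id_gaussianReal (μ := m c) (v := 1) 1).integrable (by simp)
      have h2 : Integrable (fun o : Observation n K e => o.2)
        ((Measure.dirac (X c)).prod (gaussianReal (m c) 1)) := this.comp_snd _
      exact ((h2.sub (integrable_const _)).const_mul _).sub (integrable_const _)
    · simp [ℓ, hac]
  have heq : ∀ a, ∫ o, ℓ (a, o) ∂ν.armKernel a = ∫ o, ℓ' (a, o) ∂ν.armKernel a := by
    intro a
    by_cases hac : a = c
    · subst hac
      simp only [ℓ, ℓ', if_true]
      have hx : Integrable (fun x : ℝ => x) (gaussianReal (m a) 1) := by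
        exact (memLp_id_gaussianReal (μ := m a) (v := 1) 1).integrable (by simp)
      have hx' : Integrable (fun x : ℝ => δ * (x - m a)) (gaussianReal (m a) 1) :=
        (hx.sub (integrable_const _)).const_mul _
      rw [h a, integral_fun_snd (fun x => δ * (x - m a) - δ ^ 2 / 2),
        integral_sub hx' (integrable_const _),
        integral_const_mul, integral_sub hx (integrable_const _), integral_id_gaussianReal]
      simp
    · simp [ℓ, ℓ', hac]
  have key := integral_le_integral_withDensity_exp_add (measurable_roundSum hℓ t)
    (integrable_roundSum ν π hℓ hi t) (historyLaw_eq_withDensity π hℓ hd t) hφ hφ01 hr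
  have hS : ∫ h, roundSum ℓ h ∂historyLaw ν π t =
      -(δ ^ 2 / 2) * ∫ h, pullCount c h ∂historyLaw ν π t := by
    rw [integral_roundSum_congr ν π hℓ hℓ' hi (fun a => integrable_const
      (-(δ ^ 2 / 2) * if a = c then 1 else 0)) heq, ← integral_const_mul]
    simp only [roundSum, pullCount, ℓ', Finset.mul_sum]
  rw [hS, neg_mul, neg_neg] at key
  exact key

end TwoInstances

/-! ### The hard instances: deterministic stars. -/

section StarInstances

variable {n K e : ℕ}

/-- A deterministic star: variable `0` has the value `w` and is the only parent of every other
variable; the others have the value `w` if variable `0` has, and the value `u` otherwise. The reward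
generating variable is the first component of `c`, and the expected reward is `1 / 2 + δ` at
the second component of `c` and `1 / 2` elsewhere. -/
noncomputable def starBandit (u w : Fin (K + e)) (c : Arm n K) (δ : ℝ) : CausalBandit n K e where
  edge i j := i.val = 0 ∧ j.val ≠ 0
  acyclic i h := by
    have key : ∀ j, Relation.TransGen (fun i j : Fin n => i.val = 0 ∧ j.val ≠ 0) i j →
        i.val = 0 ∧ j.val ≠ 0 := by
      intro j h
      induction h with
      | single h => exact h
      | tail _ h ih => exact ⟨ih.1, h.2⟩
    exact (key i h).2 (key i h).1
  cpd i p := by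
    classical
    exact PMF.pure (if ∃ j, p j ≠ w then u else w)
  rewardVar := c.1
  rewardFun x := if x = Fin.castAdd e c.2 then 1 / 2 + δ else 1 / 2

/-- The values of the variables of `starBandit` under an intervention. -/
def starValues (u w : Fin (K + e)) (a : Intervention n K e) (i : Fin n) : Fin (K + e) :=
  match a with
  | none => w
  | some (j, v) => if i = j then v else if j.val = 0 ∧ v ≠ w then u else w

variable (u w : Fin (K + e)) (c : Arm n K) (δ : ℝ)

/-- Variable `0` is the only possible parent, so agreement of `x` with the forced values there is
enough. This weak hypothesis lets `starBandit_weight` treat configurations that go wrong only at a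
later variable. -/
theorem starBandit_mechanism_starValues [NeZero n] (a : Intervention n K e) (i : Fin n)
    (x : Fin n → Fin (K + e)) (hx : ∀ i : Fin n, i.val = 0 → x i = starValues u w a i) :
    (starBandit u w c δ).mechanism a i (fun j => x j) = PMF.pure (starValues u w a i) := by
  have hex : (∃ j : {j // (starBandit (n := n) u w c δ).edge j i}, x j ≠ w) ↔
      i.val ≠ 0 ∧ starValues u w a (0 : Fin n) ≠ w := by
    constructor
    · rintro ⟨⟨j, hj⟩, h⟩
      have hj0 : j = 0 := Fin.ext (by simpa using hj.1)
      subst hj0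
      exact ⟨hj.2, by rwa [← hx 0 (by simp)]⟩
    · rintro ⟨h1, h2⟩
      exact ⟨⟨0, by simp, h1⟩, by rwa [hx 0 (by simp)]⟩
  have h0 : ∀ j : Fin n, j.val = 0 ↔ j = 0 := fun j => Fin.val_eq_zero_iff
  rcases a with _ | ⟨j, v⟩
  · simp only [CausalBandit.mechanism, starValues] at hex ⊢
    simp only [starBandit] at hex ⊢
    simp [hex]
  · simp only [CausalBandit.mechanism, starValues] at hex ⊢
    split_ifs with hij h1
    · rfl
    · simp only [starBandit] at hex ⊢
      congr 1
      rw [if_pos]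
      refine hex.2 ⟨fun hi => hij (Fin.ext (hi.trans h1.1.symm)), ?_⟩
      rw [if_pos (((h0 j).1 h1.1).symm)]
      exact h1.2
    · simp only [starBandit] at hex ⊢
      congr 1
      rw [if_neg]
      intro h
      have := (hex.1 h).2
      split_ifs at this with h2
      · exact h1 ⟨(h0 j).2 h2.symm, this⟩
      · exact this rfl

theorem starBandit_weight [NeZero n] (a : Intervention n K e) (x : Fin n → Fin (K + e)) :
    (starBandit u w c δ).weight a x = if x = starValues u w a then 1 else 0 := by
  unfold CausalBandit.weight
  split_ifs with h
  · subst h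
    refine Finset.prod_eq_one fun i _ => ?_
    rw [starBandit_mechanism_starValues u w c δ a i _ (fun _ _ => rfl)]
    simp
  · by_cases h0 : x 0 = starValues u w a 0
    · obtain ⟨i, hi⟩ := Function.ne_iff.1 h
      refine Finset.prod_eq_zero (Finset.mem_univ i) ?_
      rw [starBandit_mechanism_starValues u w c δ a i]
      · simp [PMF.pure_apply, hi]
      · intro j hj
        have : j = 0 := Fin.ext (by simpa using hj)
        rwa [this]
    · refine Finset.prod_eq_zero (Finset.mem_univ 0) ?_
      have : (starBandit u w c δ).mechanism a 0 (fun j => x j) =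
          (starBandit u w c δ).mechanism a 0 (fun j => starValues u w a j) := by
        congr 1
        ext ⟨j, hj⟩
        exact absurd (by simp) hj.2
      rw [this, starBandit_mechanism_starValues u w c δ a 0 _ (fun _ _ => rfl)]
      simp [PMF.pure_apply, h0]

theorem starBandit_variableLaw [NeZero n] (a : Intervention n K e) :
    (starBandit u w c δ).variableLaw a = Measure.dirac (starValues u w a) := by
  simp [CausalBandit.variableLaw, starBandit_weight, ite_smul]

theorem starBandit_outcomeLaw [NeZero n] (a : Intervention n K e) :
    (starBandit u w c δ).outcomeLaw a = (Measure.dirac (starValues u w a)).prod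
      (gaussianReal ((starBandit u w c δ).rewardFun (starValues u w a c.1)) 1) := by
  simp only [CausalBandit.outcomeLaw, starBandit_weight, ite_smul, one_smul, zero_smul]
  simp [starBandit]

theorem starBandit_prob [NeZero n] (a : Intervention n K e) (i : Fin n) (v : Fin (K + e)) :
    (starBandit u w c δ).prob a i v = if starValues u w a i = v then 1 else 0 := by
  rw [CausalBandit.prob, starBandit_variableLaw, measureReal_def,
    Measure.dirac_apply' _ (Set.toFinite _).measurableSet]
  by_cases h : starValues u w a i = v <;> simp [Set.indicator, h]

theorem starBandit_meanReward [NeZero n] (a : Intervention n K e) :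
    (starBandit u w c δ).meanReward a =
      (starBandit u w c δ).rewardFun (starValues u w a c.1) := by
  rw [CausalBandit.meanReward, starBandit_outcomeLaw, integral_fun_snd fun x => x,
    integral_id_gaussianReal]
  simp

variable {u w c}

/-- Unless it is set directly, the reward variable takes the value `u` or `w`, and neither is the
rewarded one. -/
theorem starBandit_armMean [NeZero n] (hc : c.1 ≠ 0) (hu : u ≠ Fin.castAdd e c.2)
    (hw : w ≠ Fin.castAdd e c.2) (a : Arm n K) :
    (starBandit u w c δ).armMean a = if a = c then 1 / 2 + δ else 1 / 2 := by
  rw [CausalBandit.armMean, starBandit_meanReward]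
  simp only [Arm.toIntervention, starValues, starBandit]
  obtain ⟨i, v⟩ := a
  obtain ⟨j, v'⟩ := c
  by_cases hij : j = i
  · subst hij
    simp [Prod.ext_iff]
  · simp only [hij, if_false, Prod.mk.injEq, Ne.symm hij, false_and]
    rw [if_neg]
    split_ifs
    · exact hu
    · exact hw

theorem starBandit_hasDeterministicVariables [NeZero n] (hc : c.1 ≠ 0)
    (hu : u ≠ Fin.castAdd e c.2) (hw : w ≠ Fin.castAdd e c.2) :
    HasDeterministicVariables (starBandit u w c δ)
      (fun a => starValues u w (a.toIntervention e))
      (fun a => if a = c then 1 / 2 + δ else 1 / 2) := by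
  intro a
  beta_reduce
  rw [← starBandit_armMean δ hc hu hw a, CausalBandit.armMean, starBandit_meanReward,
    ← starBandit_outcomeLaw]
  rfl

theorem starBandit_mem_hardClass [NeZero n] (huw : u ≠ w) (hc : c.1 ≠ 0)
    (hu : u ≠ Fin.castAdd e c.2) (hw : w ≠ Fin.castAdd e c.2) (hδ : |δ| ≤ 1 / 2) {ε : ℝ}
    (hε : ε < 1) : starBandit u w c δ ∈ hardClass n K e ε := by
  refine ⟨fun a => ?_, fun a => ?_, fun i j hij => ?_, ?_⟩
  · rw [starBandit_outcomeLaw, CausalBandit.armMean, starBandit_meanReward,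
      ← Measure.snd, Measure.snd_prod]
  · rw [starBandit_armMean δ hc hu hw, Set.mem_Icc]
    rw [abs_le] at hδ
    split_ifs <;> constructor <;> linarith
  -- Setting the root to `u` moves the probability that `X_j = w` from 1 to 0.
  · refine ⟨w, u, ?_⟩
    have hji : j ≠ i := fun h => hij.2 (h ▸ hij.1)
    rw [starBandit_prob, starBandit_prob]
    simp only [starValues, if_neg hji, if_pos (And.intro hij.1 huw), if_neg huw]
    simpa using hε
  · rintro ⟨Δ, hΔ, h⟩
    -- The root is an ancestor of the reward variable, but setting it leaves the mean reward at `1 /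
    -- 2`, so no `Δ > 0` is possible.
    obtain ⟨x, hx⟩ := h 0 (Relation.TransGen.single ⟨by simp, fun h => hc (Fin.val_eq_zero_iff.1 h)⟩)
    rw [starBandit_meanReward, starBandit_meanReward] at hx
    have : (starBandit u w c δ).rewardFun (starValues u w (some (0, x)) c.1) = 1 / 2 := by
      simp only [starBandit, starValues, if_neg hc]
      rw [if_neg]
      split_ifs
      · exact hu
      · exact hw
    rw [this] at hx
    simp [starBandit, starValues, hw] at hx
    linarith

end StarInstances

/-! ### Regret lower bounds on the stars. -/

section Regret

variable {n K e : ℕ}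

theorem sum_ite_eq_mul_pullCount (c : Arm n K) (x y : ℝ) {T : ℕ} (h : History n K e T) :
    ∑ t : Fin T, (if (h t).1 = c then x + y else x) = T * x + y * pullCount c h := by
  have : ∀ t : Fin T, (if (h t).1 = c then x + y else x) =
      x + y * if (h t).1 = c then 1 else 0 := fun t => by split_ifs <;> ring
  simp only [this, Finset.sum_add_distrib, ← Finset.mul_sum, pullCount, roundSum]
  simp

variable {u w : Fin (K + e)} {c : Arm n K} {δ : ℝ}

theorem starBandit_optMean_of_nonneg [NeZero n] (hc : c.1 ≠ 0) (hu : u ≠ Fin.castAdd e c.2)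
    (hw : w ≠ Fin.castAdd e c.2) (hδ : 0 ≤ δ) : (starBandit u w c δ).optMean = 1 / 2 + δ := by
  have : Nonempty (Arm n K) := ⟨c⟩
  refine le_antisymm (ciSup_le fun a => ?_) ?_
  · rw [starBandit_armMean δ hc hu hw]
    split_ifs <;> linarith
  · refine le_trans (le_of_eq ?_) (le_ciSup (Set.finite_range _).bddAbove c)
    rw [starBandit_armMean δ hc hu hw, if_pos rfl]

theorem starBandit_optMean_of_nonpos [NeZero n] (hc : c.1 ≠ 0) (hu : u ≠ Fin.castAdd e c.2)
    (hw : w ≠ Fin.castAdd e c.2) (hδ : δ ≤ 0) : (starBandit u w c δ).optMean = 1 / 2 := by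
  have : Nonempty (Arm n K) := ⟨c⟩
  refine le_antisymm (ciSup_le fun a => ?_) ?_
  · rw [starBandit_armMean δ hc hu hw]
    split_ifs <;> linarith
  -- An action on the root differs from `c` because `c.1 ≠ 0`, so it attains `1 / 2`.
  · refine le_trans (le_of_eq ?_) (le_ciSup (Set.finite_range _).bddAbove (0, c.2))
    rw [starBandit_armMean δ hc hu hw, if_neg]
    exact fun h => hc (congrArg Prod.fst h).symm

theorem starBandit_expectedRegret_of_nonneg [NeZero n] (π : Policy n K e) (hc : c.1 ≠ 0)
    (hu : u ≠ Fin.castAdd e c.2) (hw : w ≠ Fin.castAdd e c.2) (hδ : 0 ≤ δ) (T : ℕ) :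
    expectedRegret (starBandit u w c δ) π T =
      δ * ∫ h, (T - pullCount c h) ∂historyLaw (starBandit u w c δ) π T := by
  rw [expectedRegret, starBandit_optMean_of_nonneg hc hu hw hδ, ← integral_const_mul]
  simp only [starBandit_armMean δ hc hu hw, sum_ite_eq_mul_pullCount]
  congr 1
  ext h
  ring

theorem starBandit_expectedRegret_of_nonpos [NeZero n] (π : Policy n K e) (hc : c.1 ≠ 0)
    (hu : u ≠ Fin.castAdd e c.2) (hw : w ≠ Fin.castAdd e c.2) (hδ : δ ≤ 0) (T : ℕ) :
    expectedRegret (starBandit u w c δ) π T =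
      -δ * ∫ h, pullCount c h ∂historyLaw (starBandit u w c δ) π T := by
  rw [expectedRegret, starBandit_optMean_of_nonpos hc hu hw hδ, ← integral_const_mul]
  simp only [starBandit_armMean δ hc hu hw, sum_ite_eq_mul_pullCount]
  congr 1
  ext h
  ring

/-- If `c` is not played often on an instance, then neither is it on an instance that differs
slightly in the mean reward of `c` only. -/
theorem le_integral_sub_pullCount {ν ν' : CausalBandit n K e} (π : Policy n K e)
    {X : Arm n K → Fin n → Fin (K + e)} {m m' : Arm n K → ℝ}
    (h : HasDeterministicVariables ν X m) (h' : HasDeterministicVariables ν' X m')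
    (hm : ∀ a, m' a = if a = c then m a + δ else m a) {T : ℕ} (hT : 0 < T)
    (hhalf : ∫ h, pullCount c h ∂historyLaw ν π T ≤ T / 2)
    (hgap : δ ^ 2 * ∫ h, pullCount c h ∂historyLaw ν π T ≤ 1 / 32) :
    (T : ℝ) / 4 ≤ ∫ h, (T - pullCount c h) ∂historyLaw ν' π T := by
  have := h.isMarkovKernel
  have hT0 : (0 : ℝ) < T := by exact_mod_cast hT
  -- With `r = 1 / 8` both error terms are at most `1 / 8`, so the expected fraction of rounds
  -- without `c` falls from at least `1 / 2` to no less than `1 / 4`.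
  have key := integral_historyLaw_le_of_deterministic π h h' hm T
    (φ := fun h => (T - pullCount c h) / T)
    (((measurable_pullCount c T).const_sub _).div_const _)
    (fun h => ⟨div_nonneg (sub_nonneg.2 (pullCount_le c h)) hT0.le,
      (div_le_one hT0).2 (by linarith [pullCount_nonneg c h])⟩) (r := 1 / 8) (by norm_num)
  rw [integral_div, integral_div, integral_sub (integrable_const _)
    (integrable_pullCount ν π c T)] at key
  simp only [integral_const, probReal_univ, one_smul] at key
  rw [sub_div, div_self hT0.ne'] at key
  have h1 : (∫ h, pullCount c h ∂historyLaw ν π T) / T ≤ 1 / 2 := by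
    rw [div_le_iff₀ hT0]; linarith
  have h2 : 1 / 4 ≤ (∫ h, (T - pullCount c h) ∂historyLaw ν' π T) / T := by linarith
  rw [le_div_iff₀ hT0] at h2
  linarith

/-- Many actions: a bandit problem in which the best action is one of the elements of `C`. -/
theorem exists_starBandit_expectedRegret_ge_of_two_le_card [NeZero n] (π : Policy n K e)
    (C : Finset (Arm n K))
    (hC : ∀ c ∈ C, c.1 ≠ 0 ∧ u ≠ Fin.castAdd e c.2 ∧ w ≠ Fin.castAdd e c.2)
    (hcard : 2 ≤ C.card) {T : ℕ} (hT : C.card ≤ T) :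
    ∃ c ∈ C, ∃ δ : ℝ, |δ| ≤ 1 / 2 ∧
      √(C.card * T) / 32 ≤ expectedRegret (starBandit u w c δ) π T := by
  have hT0 : (0 : ℝ) < T := by exact_mod_cast (by omega : 0 < T)
  have hN2 : (2 : ℝ) ≤ C.card := by exact_mod_cast hcard
  have hNT : (C.card : ℝ) ≤ T := by exact_mod_cast hT
  obtain ⟨c₀, hc₀⟩ : C.Nonempty := Finset.card_pos.1 (by omega)
  have hdet : ∀ c ∈ C, ∀ δ, HasDeterministicVariables (starBandit u w c δ)
      (fun a => starValues u w (a.toIntervention e))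
      (fun a => if a = c then 1 / 2 + δ else 1 / 2) := fun c hc δ =>
    starBandit_hasDeterministicVariables δ (hC c hc).1 (hC c hc).2.1 (hC c hc).2.2
  have := (hdet c₀ hc₀ 0).isMarkovKernel
  set P := historyLaw (starBandit u w c₀ 0) π T with hP
  -- Pigeonhole under the reference instance: at `δ = 0` the choice of `c₀` does not affect the law
  -- of the observations.
  obtain ⟨c, hc, hcT⟩ : ∃ c ∈ C, ∫ h, pullCount c h ∂P ≤ T / C.card := by
    refine Finset.exists_le_of_sum_le ⟨c₀, hc₀⟩ ?_
    rw [← integral_finsetSum _ fun c _ => integrable_pullCount _ π c T]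
    calc ∫ h, ∑ c ∈ C, pullCount c h ∂P ≤ ∫ _h, (T : ℝ) ∂P :=
          integral_mono (integrable_finsetSum _ fun c _ => integrable_pullCount _ π c T)
            (integrable_const _) fun h => sum_pullCount_le C h
      _ = ∑ _c ∈ C, (T : ℝ) / C.card := by
          simp only [integral_const, probReal_univ, one_smul, Finset.sum_const, nsmul_eq_mul]
          field_simp
  -- At this scale `δ ^ 2 * (T / C.card) = 1 / 64`, while `δ * T` is of order `√(C.card * T)`.
  set δ : ℝ := √(C.card / T) / 8 with hδ
  have hδ0 : 0 ≤ δ := by positivity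
  have hδ2 : δ ^ 2 = C.card / T / 64 := by
    rw [hδ, div_pow, Real.sq_sqrt (by positivity)]; norm_num
  refine ⟨c, hc, δ, ?_, ?_⟩
  · rw [abs_of_nonneg hδ0, hδ]
    have : √((C.card : ℝ) / T) ≤ 1 := Real.sqrt_le_one.2 ((div_le_one hT0).2 hNT)
    linarith
  · obtain ⟨h1, h2, h3⟩ := hC c hc
    rw [starBandit_expectedRegret_of_nonneg π h1 h2 h3 hδ0]
    -- Two candidates are needed here: only then is `T / C.card ≤ T / 2`.
    have key := le_integral_sub_pullCount π (hdet c₀ hc₀ 0) (hdet c hc δ) (c := c) (δ := δ)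
      (fun a => by simp) (by omega) (hcT.trans (by gcongr)) (by
        calc _ ≤ δ ^ 2 * (T / C.card) := by gcongr
          _ ≤ 1 / 32 := by rw [hδ2]; field_simp; norm_num)
    have hs : √((C.card : ℝ) * T) = √(C.card / T) * T := by
      rw [← Real.sqrt_sq hT0.le, ← Real.sqrt_mul (by positivity), Real.sqrt_sq hT0.le]
      congr 1
      field_simp
    calc √((C.card : ℝ) * T) / 32 = δ * (T / 4) := by rw [hs, hδ]; ring
      _ ≤ _ := by gcongr

/-- A single uncertain action, whose mean reward is above or below that of the others. -/
theorem exists_starBandit_expectedRegret_ge [NeZero n] (π : Policy n K e) (hc : c.1 ≠ 0)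
    (hu : u ≠ Fin.castAdd e c.2) (hw : w ≠ Fin.castAdd e c.2) {T : ℕ} (hT : 0 < T) :
    ∃ δ : ℝ, |δ| ≤ 1 / 2 ∧ √T / 32 ≤ expectedRegret (starBandit u w c δ) π T := by
  have hT1 : (1 : ℝ) ≤ T := by exact_mod_cast hT
  have hT0 : (0 : ℝ) < T := by linarith
  have hs0 : 0 < √(T : ℝ) := Real.sqrt_pos.2 hT0
  have hss : √(T : ℝ) * √T = T := Real.mul_self_sqrt hT0.le
  set δ : ℝ := 1 / (8 * √T) with hδ
  have hδ0 : 0 ≤ δ := by positivity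
  have hδT : δ * T = √T / 8 := by
    rw [hδ]
    nth_rw 2 [← hss]
    field_simp
  have hδ1 : |δ| ≤ 1 / 2 := by
    rw [abs_of_nonneg hδ0, hδ]
    have : 1 ≤ √(T : ℝ) := Real.one_le_sqrt.2 hT1
    exact one_div_le_one_div_of_le (by norm_num) (by linarith)
  have hdet := fun δ => starBandit_hasDeterministicVariables δ hc hu hw
  have := (hdet (-δ)).isMarkovKernel
  -- A policy that plays `c` more than half the time pays where `c` is worse. Otherwise it can
  -- hardly detect the change of `2 * δ` in the mean, and pays where `c` is better.
  by_cases hhalf : ∫ h, pullCount c h ∂historyLaw (starBandit u w c (-δ)) π T ≤ T / 2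
  · refine ⟨δ, hδ1, ?_⟩
    rw [starBandit_expectedRegret_of_nonneg π hc hu hw hδ0]
    have key := le_integral_sub_pullCount π (hdet (-δ)) (hdet δ) (c := c) (δ := 2 * δ)
      (fun a => by split_ifs <;> ring) hT hhalf (by
        calc _ ≤ (2 * δ) ^ 2 * (T / 2) := by gcongr
          _ = 2 * (δ * T) ^ 2 / T := by field_simp
          _ ≤ 1 / 32 := by
              rw [hδT, div_pow, Real.sq_sqrt hT0.le]
              field_simp
              norm_num)
    calc √(T : ℝ) / 32 = δ * T / 4 := by rw [hδT]; ring
      _ = δ * (T / 4) := by ring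
      _ ≤ _ := by gcongr
  · refine ⟨-δ, by rwa [abs_neg], ?_⟩
    rw [starBandit_expectedRegret_of_nonpos π hc hu hw (by linarith), neg_neg]
    calc √(T : ℝ) / 32 ≤ δ * T / 2 := by rw [hδT]; linarith
      _ = δ * (T / 2) := by ring
      _ ≤ _ := by
          have := (not_le.1 hhalf).le
          gcongr

end Regret

/-! ### The minimax bound. -/

theorem theorem5 :
    ∃ c : ℝ, 0 < c ∧
      ∀ (n K e T : ℕ) (ε : ℝ), 2 ≤ n → 1 ≤ K → 3 ≤ K + e → n * K ≤ T → 0 < ε → ε < 1 →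
        ((c * √((n : ℝ) * K * T) : ℝ) : EReal) ≤
          ⨅ π : Policy n K e, ⨆ ν ∈ hardClass n K e ε, ((expectedRegret ν π T : ℝ) : EReal) := by
  -- `96 = 3 * 32`: the 32 comes from the regret bounds, and the 3 bounds `√6`, the cost of passing
  -- from `n * K` to `C.card`.
  refine ⟨1 / 96, by norm_num, fun n K e T ε hn hK hM hT _ hε => le_iInf fun π => ?_⟩
  have : NeZero n := ⟨by omega⟩
  have hKpos : 0 < K := hK
  -- The last two domain values serve as `u` and `w`, so that as few settable values as possible are
  -- lost as candidates.
  let u : Fin (K + e) := ⟨K + e - 2, by omega⟩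
  let w : Fin (K + e) := ⟨K + e - 1, by omega⟩
  have huw : u ≠ w := by simp only [u, w, ne_eq, Fin.mk.injEq]; omega
  let C : Finset (Arm n K) :=
    (Finset.univ.erase 0) ×ˢ (Finset.univ.filter fun v : Fin K => v.val < K + e - 2)
  have hC : ∀ c ∈ C, c.1 ≠ 0 ∧ u ≠ Fin.castAdd e c.2 ∧ w ≠ Fin.castAdd e c.2 := by
    intro c hc
    simp only [C, Finset.mem_product, Finset.mem_erase, Finset.mem_filter, Finset.mem_univ,
      true_and, and_true] at hc
    refine ⟨hc.1, ?_, ?_⟩ <;> simp only [u, w, ne_eq, Fin.ext_iff, Fin.val_castAdd] <;> omega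
  have hcard : C.card = (n - 1) * min K (K + e - 2) := by
    simp only [C, Finset.card_product, Fin.card_filter_val_lt]
    simp
  have hcard6 : n * K ≤ 6 * C.card := by
    rw [hcard]
    -- The factor 2 is attained at `n = 2`, the factor 3 at `K = 3`, `e = 0`, where one of three
    -- settable values remains.
    calc n * K ≤ (2 * (n - 1)) * (3 * min K (K + e - 2)) := Nat.mul_le_mul (by omega) (by omega)
      _ = _ := by ring
  have hcardT : C.card ≤ T := by
    rw [hcard]
    exact (Nat.mul_le_mul (by omega) (min_le_left _ _)).trans hT
  have hnK : 0 < n * K := by positivity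
  obtain ⟨c, hc, δ, hδ, hreg⟩ : ∃ c ∈ C, ∃ δ : ℝ, |δ| ≤ 1 / 2 ∧
      √(C.card * T) / 32 ≤ expectedRegret (starBandit u w c δ) π T := by
    -- A single candidate does occur, for instance with `n = 2` and `K = 1`.
    rcases (by omega : 2 ≤ C.card ∨ C.card = 1) with h2 | h1
    · exact exists_starBandit_expectedRegret_ge_of_two_le_card π C hC h2 hcardT
    · obtain ⟨c, hc⟩ : C.Nonempty := Finset.card_pos.1 (by omega)
      obtain ⟨hc0, hcu, hcw⟩ := hC c hc
      obtain ⟨δ, hδ, h⟩ := exists_starBandit_expectedRegret_ge π hc0 hcu hcw (T := T) (by omega)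
      exact ⟨c, hc, δ, hδ, by simpa [h1] using h⟩
  obtain ⟨hc0, hcu, hcw⟩ := hC c hc
  refine le_iSup₂_of_le (starBandit u w c δ)
    (starBandit_mem_hardClass δ huw hc0 hcu hcw hδ hε) (EReal.coe_le_coe_iff.2 ?_)
  refine le_trans ?_ hreg
  have h6 : (n : ℝ) * K ≤ 6 * C.card := by exact_mod_cast hcard6
  have : √((n : ℝ) * K * T) ≤ 3 * √(C.card * T) := by
    rw [Real.sqrt_le_left (by positivity), mul_pow, Real.sq_sqrt (by positivity)]
    nlinarith [mul_le_mul_of_nonneg_right h6 (Nat.cast_nonneg (α := ℝ) T),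
      mul_nonneg (Nat.cast_nonneg (α := ℝ) C.card) (Nat.cast_nonneg (α := ℝ) T)]
  linarith
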